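/- Let $k$ be a commutative ring with $1$. By a $k$-algebra we mean a commutative associative $k$-algebra, not necessarily with identity; $\mathbf{Alg}$ is the category of $k$-algebras and $k$-algebra homomorphisms, and $\mathbf{SimpAlg}$ is the category of simplicial objects in $\mathbf{Alg}$. An action of an algebra $R$ on an algebra $C$ is a $k$-bilinear map $R\times C\to C$, $(r,c)\mapsto r\cdot c$, with $(rs)\cdot c=r\cdot(s\cdot c)$ and $r\cdot(cc')=(r\cdot c)c'$. A \emph{2-crossed complex} is a sequence of $k$-algebra homomorphisms $$\cdots\to C_n\xrightarrow{\partial_n}C_{n-1}\to\cdots\to C_3\xrightarrow{\partial_3}C_2\xrightarrow{\partial_2}C_1\xrightarrow{\partial_1}C_0$$ with $\partial_n\partial_{n+1}=0$ for $n\ge 1$, together with an action of $C_0$ on every $C_n$ (by multiplication on $C_0$) for which each $\partial_n$ is $C_0$-equivariant, an action of $C_1$ on $C_2$, and a $k$-bilinear map (Peiffer lifting) $\{\ \otimes\ \}:C_1\times C_1\to C_2$, such that: (a) $\partial_2:C_2\to C_1$ is a crossed module, i.e. $\partial_2(y\cdot x)=y\,\partial_2(x)$ and $\partial_2(x)\cdot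 x'=xx'$, and $z\cdot(y\cdot x)=(z\cdot y)\cdot x=y\cdot(z\cdot x)$ for $z\in C_0$, $y\in C_1$, $x,x'\in C_2$; (b) for $x,x_1,x_2\in C_2$, $y,y_0,y_1,y_2\in C_1$, $z\in C_0$: $\partial_2\{y_0\otimes y_1\}=y_0y_1-\partial_1(y_1)\cdot y_0$; $\{\partial_2x_1\otimes\partial_2x_2\}=x_1x_2$; $\{y_0\otimes y_1y_2\}=\{y_0y_1\otimes y_2\}+\partial_1(y_2)\cdot\{y_0\otimes y_1\}$; $\{\partial_2x\otimes y\}=y\cdot x-\partial_1(y)\cdot x$; $\{y\otimes\partial_2x\}=y\cdot x$; $z\cdot\{y_0\otimes y_1\}=\{z\cdot y_0\otimes y_1\}=\{y_0\otimes z\cdot y_1\}$; (c) for $n\ge 3$, $C_n$ is a module over $C_0/\partial_1(C_1)$: it has zero multiplication, and $\partial_1(C_1)$ acts trivially on it. A morphism of 2-crossed complexes is a family of algebra homomorphisms $C_n\to C_n'$ commuting with the maps $\partial_n$, the actions and the Peiffer liftings. This gives the category $\mathbf{2\text{-}CrsComp}$. For a simplicial algebra $\mathbf E$ let $NE_n=\bigcap_{i=0}^{n-1}\mathrm{Ker}(d_i:E_n\to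 E_{n-1})$ (so $NE_0=E_0$), with differential $\partial_n:NE_n\to NE_{n-1}$ the restriction of $d_n$. Let $D_n\subseteq E_n$ be generated by the degenerate elements $s_iy$, either as a subalgebra for all $n$ and all $\mathbf E$, or as an ideal of $E_n$ for all $n$ and all $\mathbf E$. With either choice of $D_n$ there is a functor $\mathbf C^{(2)}:\mathbf{SimpAlg}\to\mathbf{2\text{-}CrsComp}$ whose terms are (up to isomorphism, natural in $\mathbf E$) the quotient algebras $$C_0=NE_0,\qquad C_1=NE_1,\qquad C_2=\frac{NE_2}{\partial_3(NE_3\cap D_3)},\qquad C_n=\frac{NE_n}{(NE_n\cap D_n)+\partial_{n+1}(NE_{n+1}\cap D_{n+1})}\quad(n\ge 3).$$ Under these identifications the maps $\partial_n$ are induced by the differential of $\mathbf{NE}$; $z\in C_0$ acts on $C_n$ by multiplication by $s_0^n(z)$; $y\in C_1$ acts on $C_2$ by multiplication by $s_1(y)$; the Peiffer lifting sends $(y_0,y_1)$ to the class of $s_1(y_0)\,(s_1(y_1)-s_0(y_1))$; and $\mathbf C^{(2)}$ sends a morphism of simplicial algebras to the morphism that it induces on these quotients. -/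

import Mathlib

open CategoryTheory
open scoped Simplicial

universe u v

namespace TwoCrossed

/-- Commutative (associative) algebras over the commutative ground ring `k`, not required to have
a multiplicative identity. -/
structure CAlg (k : Type u) [CommRing k] where
  carrier : Type v
  [ring : NonUnitalCommRing carrier]
  [module : Module k carrier]
  [isScalarTower : IsScalarTower k carrier carrier]
  [smulCommClass : SMulCommClass k carrier carrier]

attribute [instance] CAlg.ring CAlg.module CAlg.isScalarTower CAlg.smulCommClass

instance (k : Type u) [CommRing k] : CoeSort (CAlg.{u, v} k) (Type v) := ⟨CAlg.carrier⟩

/-- The category `Alg` of commutative `k`-algebras: morphisms are the `k`-linear multiplicative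
maps. -/
instance (k : Type u) [CommRing k] : Category (CAlg.{u, v} k) where
  Hom A B := A →ₙₐ[k] B
  id A := NonUnitalAlgHom.id k A
  comp f g := NonUnitalAlgHom.comp g f

/-- The category `SimpAlg` of simplicial commutative `k`-algebras. -/
abbrev SimpAlg (k : Type u) [CommRing k] := SimplicialObject (CAlg.{u, v} k)

section Simplicial

variable {k : Type u} [CommRing k]

/-- The face operator `dᵢ : E_{n+1} → E_n`, `0 ≤ i ≤ n + 1`. -/
def face (E : SimpAlg.{u, v} k) (n : ℕ) (i : Fin (n + 2)) : E _⦋n + 1⦌ →ₙₐ[k] E _⦋n⦌ := E.δ i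

/-- The degeneracy operator `sᵢ : E_n → E_{n+1}`, `0 ≤ i ≤ n`. -/
def degen (E : SimpAlg.{u, v} k) (n : ℕ) (i : Fin (n + 1)) : E _⦋n⦌ →ₙₐ[k] E _⦋n + 1⦌ := E.σ i

/-- The total degeneracy `s₀ⁿ : E_0 → E_n`, induced by the unique map `[n] → [0]`. -/
def totalDegen (E : SimpAlg.{u, v} k) (n : ℕ) : E _⦋0⦌ →ₙₐ[k] E _⦋n⦌ :=
  E.map (SimplexCategory.const ⦋n⦌ ⦋0⦌ 0).op

/-- The component in degree `n` of a morphism of simplicial algebras. -/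
def component {E E' : SimpAlg.{u, v} k} (f : E ⟶ E') (n : ℕ) : E _⦋n⦌ →ₙₐ[k] E' _⦋n⦌ :=
  f.app (Opposite.op ⦋n⦌)

theorem face_face (E : SimpAlg.{u, v} k) (n : ℕ) {i j : Fin (n + 2)} (h : i ≤ j)
    (x : E _⦋n + 2⦌) :
    face E n i (face E (n + 1) j.succ x) = face E n j (face E (n + 1) i.castSucc x) :=
  congrArg (fun g : E _⦋n + 2⦌ →ₙₐ[k] E _⦋n⦌ => g x) (E.δ_comp_δ h)

theorem face_component {E E' : SimpAlg.{u, v} k} (f : E ⟶ E') (n : ℕ) (i : Fin (n + 2))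
    (x : E _⦋n + 1⦌) :
    face E' n i (component f (n + 1) x) = component f n (face E n i x) :=
  congrArg (fun g : E _⦋n + 1⦌ →ₙₐ[k] E' _⦋n⦌ => g x) (SimplicialObject.δ_naturality f i).symm

/-- The Moore complex: `NE_n = ⋂_{i < n} Ker (dᵢ : E_n → E_{n-1})`, so that `NE_0 = E_0`. -/
def NE (E : SimpAlg.{u, v} k) (n : ℕ) : NonUnitalSubalgebra k (E _⦋n⦌) :=
  match n with
  | 0 => ⊤
  | n + 1 =>
    { carrier := {x | ∀ i : Fin (n + 1), face E n i.castSucc x = 0}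
      add_mem' := fun {x y} hx hy i => by rw [map_add, hx i, hy i, add_zero]
      zero_mem' := fun i => map_zero _
      mul_mem' := fun {x y} hx _ i => by rw [map_mul, hx i, zero_mul]
      smul_mem' := fun c x hx i => by rw [map_smul, hx i, smul_zero] }

theorem mul_mem_NE (E : SimpAlg.{u, v} k) (n : ℕ) (a : E _⦋n⦌) {x : E _⦋n⦌}
    (hx : x ∈ NE E n) : a * x ∈ NE E n :=
  match n, a, x, hx with
  | 0, _, _, _ => NonUnitalAlgebra.mem_top
  | _ + 1, _, _, hx => fun i => by rw [map_mul, hx i, mul_zero]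

theorem component_mem_NE {E E' : SimpAlg.{u, v} k} (f : E ⟶ E') (n : ℕ) {x : E _⦋n⦌}
    (hx : x ∈ NE E n) : component f n x ∈ NE E' n :=
  match n, x, hx with
  | 0, _, _ => NonUnitalAlgebra.mem_top
  | _ + 1, _, hx => fun i => by rw [face_component, hx i, map_zero]

theorem lastFace_mem_NE (E : SimpAlg.{u, v} k) (n : ℕ) {x : E _⦋n + 1⦌}
    (hx : x ∈ NE E (n + 1)) : face E n (Fin.last (n + 1)) x ∈ NE E n :=
  match n, x, hx with
  | 0, _, _ => NonUnitalAlgebra.mem_top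
  | n + 1, x, hx => fun i => by
    have h := face_face E n (i := i.castSucc) (j := Fin.last (n + 1)) (Fin.le_last _) x
    rw [Fin.succ_last, hx i.castSucc, map_zero] at h
    exact h

/-- The differential `∂ : NE_{n+1} → NE_n`, the restriction of the last face `d_{n+1}`. -/
def NEd (E : SimpAlg.{u, v} k) (n : ℕ) : NE E (n + 1) →ₗ[k] NE E n where
  toFun x := ⟨face E n (Fin.last (n + 1)) x, lastFace_mem_NE E n x.2⟩
  map_add' x y := Subtype.ext (map_add (face E n (Fin.last (n + 1))) (x : E _⦋n + 1⦌) y)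
  map_smul' c x := Subtype.ext (map_smul (face E n (Fin.last (n + 1))) c (x : E _⦋n + 1⦌))

/-- The map `NE_n → NE'_n` induced by a morphism of simplicial algebras. -/
def NEmap {E E' : SimpAlg.{u, v} k} (f : E ⟶ E') (n : ℕ) (x : NE E n) : NE E' n :=
  ⟨component f n x, component_mem_NE f n x.2⟩

/-- Multiplication of an element of `NE_n` by an element of `E_n` (`NE_n` is an ideal of `E_n`). -/
def mulNE (E : SimpAlg.{u, v} k) (n : ℕ) (a : E _⦋n⦌) (x : NE E n) : NE E n :=
  ⟨a * x, mul_mem_NE E n a x.2⟩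

theorem peiffer_mem_NE (E : SimpAlg.{u, v} k) (x y : NE E 1) :
    degen E 1 1 x * (degen E 1 1 y - degen E 1 0 y) ∈ NE E 2 := by
  have h0 : face E 1 0 (degen E 1 1 x) = 0 := by
    have h := congrArg (fun g : E _⦋1⦌ →ₙₐ[k] E _⦋1⦌ => g x)
      (E.δ_comp_σ_of_le (i := (0 : Fin 2)) (j := (0 : Fin 1)) (Fin.zero_le _))
    refine Eq.trans h ?_
    change degen E 0 0 (face E 0 (Fin.castSucc 0) (x : E _⦋1⦌)) = 0
    rw [x.2 0, map_zero]
  have h1 : face E 1 1 (degen E 1 1 y) = y :=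
    congrArg (fun g : E _⦋1⦌ →ₙₐ[k] E _⦋1⦌ => g y) (E.δ_comp_σ_self (i := (1 : Fin 2)))
  have h2 : face E 1 1 (degen E 1 0 y) = y :=
    congrArg (fun g : E _⦋1⦌ →ₙₐ[k] E _⦋1⦌ => g y) (E.δ_comp_σ_succ (i := (0 : Fin 2)))
  intro i
  fin_cases i
  · change face E 1 0 _ = 0
    rw [map_mul, h0, zero_mul]
  · change face E 1 1 _ = 0
    rw [map_mul, map_sub, h1, h2, sub_self, mul_zero]

/-- The element `s₁x (s₁y - s₀y)` of `NE_2`, for `x`, `y` in `NE_1`. -/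
def peiffer (E : SimpAlg.{u, v} k) (x y : NE E 1) : NE E 2 :=
  ⟨degen E 1 1 x * (degen E 1 1 y - degen E 1 0 y), peiffer_mem_NE E x y⟩

/-- The degenerate elements of `E_n`: those of the form `sᵢ y` (none for `n = 0`). -/
def degenerate (E : SimpAlg.{u, v} k) (n : ℕ) : Set (E _⦋n⦌) :=
  match n with
  | 0 => ∅
  | n + 1 => {x | ∃ (i : Fin (n + 1)) (y : E _⦋n⦌), degen E n i y = x}

/-- The two current conventions for the degenerate part `D_n` of `E_n`. -/
inductive DegenerateConvention where
  /-- `D_n` is the subalgebra of `E_n` generated by the degenerate elements. -/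
  | subalgebra
  /-- `D_n` is the ideal of `E_n` generated by the degenerate elements. -/
  | ideal

/-- The ideal of a (non-unital) `k`-algebra generated by a subset: the least `k`-submodule that
contains the subset and absorbs multiplication. -/
def idealSpan {A : CAlg.{u, v} k} (s : Set A) : Submodule k A :=
  sInf {M | s ⊆ M ∧ ∀ a : A, ∀ x ∈ M, a * x ∈ M}

/-- The degenerate part `D_n` of `E_n`. -/
def D (conv : DegenerateConvention) (E : SimpAlg.{u, v} k) (n : ℕ) : Submodule k (E _⦋n⦌) :=
  match conv with
  | .subalgebra => (NonUnitalAlgebra.adjoin k (degenerate E n)).toSubmodule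
  | .ideal => idealSpan (degenerate E n)

/-- `NE_n ∩ D_n`, as a submodule of `NE_n`. -/
def NEcapD (conv : DegenerateConvention) (E : SimpAlg.{u, v} k) (n : ℕ) : Submodule k (NE E n) :=
  (D conv E n).comap (NE E n).toSubmodule.subtype

/-- The submodule of `NE_n` that is divided out: `0` for `n = 0, 1`; `∂₃(NE_3 ∩ D_3)` for `n = 2`;
and `(NE_n ∩ D_n) + ∂_{n+1}(NE_{n+1} ∩ D_{n+1})` for `n ≥ 3`. -/
def relations (conv : DegenerateConvention) (E : SimpAlg.{u, v} k) (n : ℕ) :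
    Submodule k (NE E n) :=
  match n with
  | 0 => ⊥
  | 1 => ⊥
  | 2 => (NEcapD conv E 3).map (NEd E 2)
  | n + 3 => NEcapD conv E (n + 3) ⊔ (NEcapD conv E (n + 4)).map (NEd E (n + 3))

end Simplicial

/-- A 2-crossed complex of commutative `k`-algebras
`⋯ → C_n → C_{n-1} → ⋯ → C_3 → C_2 → C_1 → C_0`. -/
structure TwoCrsComp (k : Type u) [CommRing k] where
  C : ℕ → CAlg.{u, v} k
  /-- The boundary `∂_{n+1} : C_{n+1} → C_n`. -/
  d (n : ℕ) : C (n + 1) →ₙₐ[k] C n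
  d_d (n : ℕ) (x : C (n + 2)) : d n (d (n + 1) x) = 0
  /-- The action of `C_0` on `C_n`, by multiplication for `n = 0`. -/
  act (n : ℕ) : C 0 →ₗ[k] C n →ₗ[k] C n
  act_zero (r x : C 0) : act 0 r x = r * x
  mul_act (n : ℕ) (r s : C 0) (x : C n) : act n (r * s) x = act n r (act n s x)
  act_mul (n : ℕ) (r : C 0) (x y : C n) : act n r (x * y) = act n r x * y
  d_act (n : ℕ) (r : C 0) (x : C (n + 1)) : d n (act (n + 1) r x) = act n r (d n x)
  /-- The action of `C_1` on `C_2`, for which `∂_2 : C_2 → C_1` is a crossed module. -/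
  act₁ : C 1 →ₗ[k] C 2 →ₗ[k] C 2
  mul_act₁ (y y' : C 1) (x : C 2) : act₁ (y * y') x = act₁ y (act₁ y' x)
  act₁_mul (y : C 1) (x x' : C 2) : act₁ y (x * x') = act₁ y x * x'
  act_act₁ (r : C 0) (y : C 1) (x : C 2) : act 2 r (act₁ y x) = act₁ (act 1 r y) x
  act₁_act (r : C 0) (y : C 1) (x : C 2) : act 2 r (act₁ y x) = act₁ y (act 2 r x)
  d_act₁ (y : C 1) (x : C 2) : d 1 (act₁ y x) = y * d 1 x
  act₁_d (x x' : C 2) : act₁ (d 1 x) x' = x * x'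
  /-- The Peiffer lifting `{ ⊗ } : C_1 ⊗_{C_0} C_1 → C_2`. -/
  lift : C 1 →ₗ[k] C 1 →ₗ[k] C 2
  d_lift (y₀ y₁ : C 1) : d 1 (lift y₀ y₁) = y₀ * y₁ - act 1 (d 0 y₁) y₀
  lift_d_d (x₁ x₂ : C 2) : lift (d 1 x₁) (d 1 x₂) = x₁ * x₂
  lift_mul (y₀ y₁ y₂ : C 1) :
    lift y₀ (y₁ * y₂) = lift (y₀ * y₁) y₂ + act 2 (d 0 y₂) (lift y₀ y₁)
  lift_d_left (x : C 2) (y : C 1) : lift (d 1 x) y = act₁ y x - act 2 (d 0 y) x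
  lift_d_right (y : C 1) (x : C 2) : lift y (d 1 x) = act₁ y x
  lift_act_left (r : C 0) (y₀ y₁ : C 1) : lift (act 1 r y₀) y₁ = act 2 r (lift y₀ y₁)
  lift_act_right (r : C 0) (y₀ y₁ : C 1) : lift y₀ (act 1 r y₁) = act 2 r (lift y₀ y₁)
  /-- For `n ≥ 3`, `∂_1(C_1)` acts trivially on `C_n`: the action is one of `C_0 / ∂_1(C_1)`. -/
  act_d (n : ℕ) (hn : 3 ≤ n) (y : C 1) (x : C n) : act n (d 0 y) x = 0
  /-- For `n ≥ 3`, `C_n` is just a module, that is, an algebra with zero multiplication. -/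
  mul_eq_zero (n : ℕ) (hn : 3 ≤ n) (x x' : C n) : x * x' = 0

namespace TwoCrsComp

variable {k : Type u} [CommRing k]

/-- A morphism of 2-crossed complexes: a morphism of chain complexes of algebras compatible with
the actions and with the Peiffer liftings. -/
@[ext]
structure Hom (X Y : TwoCrsComp.{u, v} k) where
  f (n : ℕ) : X.C n →ₙₐ[k] Y.C n
  f_d (n : ℕ) (x : X.C (n + 1)) : f n (X.d n x) = Y.d n (f (n + 1) x)
  f_act (n : ℕ) (r : X.C 0) (x : X.C n) : f n (X.act n r x) = Y.act n (f 0 r) (f n x)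
  f_act₁ (y : X.C 1) (x : X.C 2) : f 2 (X.act₁ y x) = Y.act₁ (f 1 y) (f 2 x)
  f_lift (y₀ y₁ : X.C 1) : f 2 (X.lift y₀ y₁) = Y.lift (f 1 y₀) (f 1 y₁)

/-- The category `2-CrsComp` of 2-crossed complexes. -/
instance : Category (TwoCrsComp.{u, v} k) where
  Hom := Hom
  id X :=
    { f := fun n => NonUnitalAlgHom.id k (X.C n)
      f_d := fun _ _ => rfl
      f_act := fun _ _ _ => rfl
      f_act₁ := fun _ _ => rfl
      f_lift := fun _ _ => rfl }
  comp {X Y Z} g h :=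
    { f := fun n => (h.f n).comp (g.f n)
      f_d := fun n x => by simp [g.f_d, h.f_d]
      f_act := fun n r x => by simp [g.f_act, h.f_act]
      f_act₁ := fun y x => by simp [g.f_act₁, h.f_act₁]
      f_lift := fun y₀ y₁ => by simp [g.f_lift, h.f_lift] }

/-- The component in degree `n` of a morphism of 2-crossed complexes. -/
def component {X Y : TwoCrsComp.{u, v} k} (g : X ⟶ Y) (n : ℕ) : X.C n →ₙₐ[k] Y.C n :=
  Hom.f g n

end TwoCrsComp

end TwoCrossed

namespace TwoCrossed

/-! ### Simplicial identities on the Moore complex, and operators from degree one. -/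

section Identities

variable {k : Type u} [CommRing k] (E : SimpAlg.{u, v} k)

/-! The operations are the evident ones on representatives; some axioms hold on the nose, while the
others have a defect that must lie in the relations. One device produces all these defects. Suppose
`p` and `u` in `E_{n+1}` are degenerate, every non-last face of `p` but `d_j` vanishes, and `d_j u =
0`. Then `p u` lies in `NE_{n+1} ∩ D_{n+1}`, so the product of the last faces of `p` and `u` is a
boundary that is divided out (`mem_relations_of_complementary_faces`).

For `p` one takes alternating sums of degeneracies of a Moore element `x`. For `u` one takes
degeneracies of another Moore element, or differences of consecutive operators `cut m j`, which run
from multiplication by `s₀ᵐ d₀ y = 0` to multiplication by `s₀ᵐ ∂y`. In degree 2 this gives the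
crossed module and Peiffer lifting identities. In degrees at least 3 the last face of `p` is `± x`
modulo `D`, and `D` itself is divided out, so products and the action of `∂₁(C₁)` vanish.

Of `D` only this is used: it is a submodule containing the degenerate elements, closed under
products and natural in `E`. Both conventions are therefore treated together. -/

theorem face_degen_of_lt (n : ℕ) {i : Fin (n + 2)} {j : Fin (n + 1)} (h : i ≤ j.castSucc)
    (x : E _⦋n + 1⦌) :
    face E (n + 1) i.castSucc (degen E (n + 1) j.succ x) = degen E n j (face E n i x) :=
  congrArg (fun g : E _⦋n + 1⦌ →ₙₐ[k] E _⦋n + 1⦌ => g x) (E.δ_comp_σ_of_le h)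

theorem face_degen_self (n : ℕ) (i : Fin (n + 1)) (x : E _⦋n⦌) :
    face E n i.castSucc (degen E n i x) = x :=
  congrArg (fun g : E _⦋n⦌ →ₙₐ[k] E _⦋n⦌ => g x) E.δ_comp_σ_self

theorem face_degen_succ (n : ℕ) (i : Fin (n + 1)) (x : E _⦋n⦌) :
    face E n i.succ (degen E n i x) = x :=
  congrArg (fun g : E _⦋n⦌ →ₙₐ[k] E _⦋n⦌ => g x) E.δ_comp_σ_succ

theorem face_degen_of_gt (n : ℕ) {i : Fin (n + 2)} {j : Fin (n + 1)} (h : j.castSucc < i)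
    (x : E _⦋n + 1⦌) :
    face E (n + 1) i.succ (degen E (n + 1) j.castSucc x) = degen E n j (face E n i x) :=
  congrArg (fun g : E _⦋n + 1⦌ →ₙₐ[k] E _⦋n + 1⦌ => g x) (E.δ_comp_σ_of_gt h)

/-- On the Moore complex all faces but the last of a degeneracy are trivial. -/
theorem face_degen_of_mem_NE (n : ℕ) {x : E _⦋n⦌} (hx : x ∈ NE E n) (i l : Fin (n + 1)) :
    face E n i.castSucc (degen E n l x) = if i = l ∨ i.val = l.val + 1 then x else 0 := by
  split_ifs with h
  · rcases h with rfl | h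
    · exact face_degen_self E n i x
    · have : i.castSucc = l.succ := Fin.ext (by simpa using h)
      rw [this, face_degen_succ]
  · push Not at h
    obtain ⟨h1, h2⟩ := h
    have h1' : i.val ≠ l.val := fun h => h1 (Fin.ext h)
    cases n with
    | zero => exact absurd (Fin.ext (by omega)) h1
    | succ n =>
      rcases lt_or_gt_of_ne h1' with h3 | h3
      · obtain ⟨l, rfl⟩ := Fin.exists_succ_eq.2 (show l ≠ 0 by rintro rfl; simp at h3)
        have h4 : i.val < n + 1 := by have := l.2; simp at h3; omega
        obtain ⟨i, rfl⟩ : ∃ i' : Fin (n + 1), i = i'.castSucc := ⟨⟨i, h4⟩, rfl⟩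
        have h6 : i.castSucc ≤ l.castSucc := by
          rw [Fin.le_def]
          simp at h3 ⊢
          omega
        exact (face_degen_of_lt E n h6 x).trans (by rw [hx i, map_zero])
      · have h5 : l.val + 1 < i.val := by omega
        have h4 : l.val < n + 1 := by have := i.2; omega
        obtain ⟨l, rfl⟩ : ∃ l' : Fin (n + 1), l = l'.castSucc := ⟨⟨l, h4⟩, rfl⟩
        obtain ⟨i, rfl⟩ : ∃ i' : Fin (n + 1), i = i'.succ :=
          ⟨⟨i - 1, by have := i.2; omega⟩, Fin.ext (by simp; omega)⟩
        have h6 : l.castSucc < i.castSucc := by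
          rw [Fin.lt_def]
          simp at h5 ⊢
          omega
        -- The face that reaches `x` has its index lowered by one, so it is still not the last face
        -- and kills `x`.
        exact (face_degen_of_gt E n h6 x).trans (by rw [hx i, map_zero])

theorem lastFace_degen_last (n : ℕ) (x : E _⦋n⦌) :
    face E n (Fin.last (n + 1)) (degen E n (Fin.last n) x) = x :=
  face_degen_succ E n (Fin.last n) x

theorem lastFace_degen (n : ℕ) (l : Fin (n + 1)) (x : E _⦋n + 1⦌) :
    face E (n + 1) (Fin.last (n + 2)) (degen E (n + 1) l.castSucc x) =
      degen E n l (face E n (Fin.last (n + 1)) x) :=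
  face_degen_of_gt E n (i := Fin.last (n + 1)) (Fin.castSucc_lt_last l) x

/-- The operator `E_c → E_b` induced by a monotone map `f : [b] → [c]`. -/
def operator {b c : SimplexCategory} (f : b ⟶ c) :
    E.obj (Opposite.op c) →ₙₐ[k] E.obj (Opposite.op b) :=
  E.map f.op

/-- The monotone map `[m] → [1]` that is `0` exactly on the first `j` vertices. -/
def cutMap (m j : ℕ) : ⦋m⦌ ⟶ ⦋1⦌ :=
  SimplexCategory.mkHom (n := m) (m := 1)
    ⟨fun i => if i.val < j then 0 else 1, fun a b h => by
      have : a.val ≤ b.val := h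
      dsimp only
      split_ifs <;> first | omega | simp⟩

/-- The operator `E_1 → E_m` induced by `cutMap m j`. -/
def cut (m j : ℕ) : E _⦋1⦌ →ₙₐ[k] E _⦋m⦌ :=
  operator E (cutMap m j)

theorem operator_operator {a b c : SimplexCategory} (f : a ⟶ b) (g : b ⟶ c) (h : a ⟶ c)
    (w : f ≫ g = h) (x : E.obj (Opposite.op c)) :
    operator E f (operator E g x) = operator E h x := by
  subst w
  unfold operator
  rw [op_comp, E.map_comp]
  rfl

/-- Omitting vertex `i` shortens the initial block of zeros exactly when `i` belongs to it.
Consequently the cuts at `j` and `j + 1` have the same face `d_j`, and their difference is killed by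
it. -/
theorem face_cut (m j : ℕ) (i : Fin (m + 2)) (y : E _⦋1⦌) :
    face E m i (cut E (m + 1) j y) = cut E m (if i.val < j then j - 1 else j) y := by
  refine operator_operator E _ _ _ ?_ y
  ext a : 3
  change (if (i.succAbove a).val < j then (0 : Fin 2) else 1) = if a.val < _ then 0 else 1
  congr 1
  rw [Fin.succAbove]
  simp only [Fin.lt_def, Fin.val_castSucc, eq_iff_iff]
  split_ifs <;> simp <;> omega

theorem degen_one_one (y : E _⦋1⦌) : degen E 1 1 y = cut E 2 1 y := by
  have h : SimplexCategory.σ 1 = cutMap 2 1 := by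
    ext a : 3
    fin_cases a <;> rfl
  exact congrArg (fun f => operator E f y) h

theorem degen_one_zero (y : E _⦋1⦌) : degen E 1 0 y = cut E 2 2 y := by
  have h : SimplexCategory.σ 0 = cutMap 2 2 := by
    ext a : 3
    fin_cases a <;> rfl
  exact congrArg (fun f => operator E f y) h

theorem cut_zero (m : ℕ) (y : E _⦋1⦌) : cut E m 0 y = totalDegen E m (face E 0 0 y) := by
  refine (operator_operator E _ _ _ ?_ y).symm
  ext a : 3
  rfl

theorem cut_succ (m : ℕ) (y : E _⦋1⦌) : cut E m (m + 1) y = totalDegen E m (face E 0 1 y) := by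
  refine (operator_operator E _ _ _ ?_ y).symm
  ext a : 3
  change 0 = if a.val < m + 1 then (0 : Fin 2) else 1
  rw [if_pos a.2]

theorem totalDegen_zero (x : E _⦋0⦌) : totalDegen E 0 x = x := by
  have : SimplexCategory.const ⦋0⦌ ⦋0⦌ 0 = 𝟙 _ := Subsingleton.elim _ _
  unfold totalDegen
  rw [this, op_id, E.map_id]
  rfl

theorem face_totalDegen (n : ℕ) (i : Fin (n + 2)) (x : E _⦋0⦌) :
    face E n i (totalDegen E (n + 1) x) = totalDegen E n x :=
  operator_operator E _ _ _ (Subsingleton.elim _ _) x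

theorem degen_totalDegen (n : ℕ) (i : Fin (n + 1)) (x : E _⦋0⦌) :
    degen E n i (totalDegen E n x) = totalDegen E (n + 1) x :=
  operator_operator E _ _ _ (Subsingleton.elim _ _) x

theorem degen_component {E' : SimpAlg.{u, v} k} (f : E ⟶ E') (n : ℕ) (i : Fin (n + 1))
    (x : E _⦋n⦌) :
    degen E' n i (component f n x) = component f (n + 1) (degen E n i x) :=
  congrArg (fun g : E _⦋n⦌ →ₙₐ[k] E' _⦋n + 1⦌ => g x) (SimplicialObject.σ_naturality f i).symm

theorem totalDegen_component {E' : SimpAlg.{u, v} k} (f : E ⟶ E') (n : ℕ) (x : E _⦋0⦌) :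
    totalDegen E' n (component f 0 x) = component f n (totalDegen E n x) :=
  congrArg (fun g : E _⦋0⦌ →ₙₐ[k] E' _⦋n⦌ => g x)
    (f.naturality (SimplexCategory.const ⦋n⦌ ⦋0⦌ 0).op).symm

end Identities

/-! ### Properties of the degenerate part common to both conventions. -/

section Degenerate

variable {k : Type u} [CommRing k] (conv : DegenerateConvention) (E : SimpAlg.{u, v} k)

theorem subset_idealSpan {A : CAlg.{u, v} k} (s : Set A) : s ⊆ idealSpan s :=
  fun _ hx => Submodule.mem_sInf.2 fun _ hM => hM.1 hx

theorem mul_mem_idealSpan {A : CAlg.{u, v} k} (s : Set A) (a : A) {x : A} (hx : x ∈ idealSpan s) :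
    a * x ∈ idealSpan s :=
  Submodule.mem_sInf.2 fun M hM => hM.2 a x (Submodule.mem_sInf.1 hx M hM)

theorem degenerate_subset_D (n : ℕ) : degenerate E n ⊆ D conv E n := by
  cases conv
  · exact NonUnitalAlgebra.subset_adjoin k
  · exact subset_idealSpan _

theorem degen_mem_D (n : ℕ) (i : Fin (n + 1)) (y : E _⦋n⦌) : degen E n i y ∈ D conv E (n + 1) :=
  degenerate_subset_D conv E (n + 1) ⟨i, y, rfl⟩

theorem mul_mem_D (n : ℕ) {a b : E _⦋n⦌} (ha : a ∈ D conv E n) (hb : b ∈ D conv E n) :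
    a * b ∈ D conv E n := by
  cases conv
  · exact mul_mem (S := NonUnitalSubalgebra k (E _⦋n⦌)) ha hb
  · exact mul_mem_idealSpan _ a hb

theorem component_mem_D {E' : SimpAlg.{u, v} k} (f : E ⟶ E') (n : ℕ) {x : E _⦋n⦌}
    (hx : x ∈ D conv E n) : component f n x ∈ D conv E' n := by
  have h : degenerate E n ⊆ {x | component f n x ∈ D conv E' n} := by
    intro _ hx
    cases n with
    | zero => exact hx.elim
    | succ n =>
      obtain ⟨i, y, rfl⟩ := hx
      rw [Set.mem_ofPred_eq, ← degen_component]
      exact degen_mem_D ..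
  cases conv
  · exact (NonUnitalAlgebra.adjoin_le (S := NonUnitalSubalgebra.comap (component f n)
      (NonUnitalAlgebra.adjoin k (degenerate E' n))) h) hx
  -- The preimage of an ideal is one of the absorbing submodules over which the infimum is taken.
  · refine Submodule.mem_sInf.1 hx
      ((D .ideal E' n).comap (component f n : E _⦋n⦌ →ₗ[k] E' _⦋n⦌)) ⟨h, fun a x hx => ?_⟩
    refine (congrArg (· ∈ D .ideal E' n) (map_mul (component f n) a x)).mpr ?_
    exact mul_mem_idealSpan _ _ hx

theorem totalDegen_mem_D (n : ℕ) (x : E _⦋0⦌) : totalDegen E (n + 1) x ∈ D conv E (n + 1) := by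
  rw [← degen_totalDegen E n 0]
  exact degen_mem_D ..

/-- From degree 2 on there are at least three vertices, so a map to `[1]` identifies two of them and
factors through a codegeneracy. -/
theorem cut_mem_D (n j : ℕ) (y : E _⦋1⦌) : cut E (n + 2) j y ∈ D conv E (n + 2) := by
  obtain ⟨i, g, h⟩ := SimplexCategory.eq_σ_comp_of_not_injective
    (cutMap (n + 2) j) (fun h => by
        have := Fintype.card_le_of_injective _ h
        simp at this)
  exact degenerate_subset_D conv E _ ⟨i, _, operator_operator E _ _ _ h.symm y⟩

end Degenerate

/-! ### The submodules that are divided out. -/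

section Relations

variable {k : Type u} [CommRing k] (conv : DegenerateConvention) (E : SimpAlg.{u, v} k)

theorem NEd_coe (n : ℕ) (x : NE E (n + 1)) :
    (NEd E n x : E _⦋n⦌) = face E n (Fin.last (n + 1)) x := rfl

theorem mulNE_coe (n : ℕ) (a : E _⦋n⦌) (x : NE E n) : (mulNE E n a x : E _⦋n⦌) = a * x := rfl

/-- Multiplication `E_n × NE_n → NE_n` as a bilinear map. -/
def mulNEₗ (n : ℕ) : E _⦋n⦌ →ₗ[k] NE E n →ₗ[k] NE E n :=
  LinearMap.mk₂ k (mulNE E n)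
    (fun a b x => Subtype.ext (add_mul a b (x : E _⦋n⦌)))
    (fun c a x => Subtype.ext (smul_mul_assoc c a (x : E _⦋n⦌)))
    (fun a x y => Subtype.ext (mul_add a (x : E _⦋n⦌) y))
    (fun c a x => Subtype.ext (mul_smul_comm c a (x : E _⦋n⦌)))

theorem mulNEₗ_apply (n : ℕ) (a : E _⦋n⦌) (x : NE E n) : mulNEₗ E n a x = mulNE E n a x := rfl

theorem boundary_mem_relations (n : ℕ) {w : NE E (n + 3)}
    (hw : (w : E _⦋n + 3⦌) ∈ D conv E (n + 3)) :
    NEd E (n + 2) w ∈ relations conv E (n + 2) := by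
  have h : NEd E (n + 2) w ∈ (NEcapD conv E (n + 3)).map (NEd E (n + 2)) :=
    Submodule.mem_map_of_mem hw
  cases n with
  | zero => exact h
  | succ n => exact Submodule.mem_sup_right h

theorem D_mem_relations (n : ℕ) {x : NE E (n + 3)} (hx : (x : E _⦋n + 3⦌) ∈ D conv E (n + 3)) :
    x ∈ relations conv E (n + 3) :=
  Submodule.mem_sup_left hx

/-- Induction principle for the relations in degrees `≥ 2`. -/
theorem relations_le (n : ℕ) {M : Submodule k (NE E (n + 2))}
    (hD : 3 ≤ n + 2 → ∀ x : NE E (n + 2), (x : E _⦋n + 2⦌) ∈ D conv E (n + 2) → x ∈ M)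
    (hd : ∀ w : NE E (n + 3), (w : E _⦋n + 3⦌) ∈ D conv E (n + 3) → NEd E (n + 2) w ∈ M) :
    relations conv E (n + 2) ≤ M := by
  have h : (NEcapD conv E (n + 3)).map (NEd E (n + 2)) ≤ M := Submodule.map_le_iff_le_comap.2 hd
  cases n with
  | zero => exact h
  | succ n => exact sup_le (hD (by omega)) h

/-! ### Boundaries of products with complementary faces, and the vanishing in degrees at least 3. -/

theorem mul_mem_NE_of_complementary_faces (n : ℕ) {p u : E _⦋n + 1⦌} (j : Fin (n + 1))
    (hp : ∀ i, i ≠ j → face E n i.castSucc p = 0) (hu : face E n j.castSucc u = 0) :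
    p * u ∈ NE E (n + 1) := by
  intro i
  by_cases h : i = j
  · rw [h, map_mul, hu, mul_zero]
  · rw [map_mul, hp i h, zero_mul]

/-- Each non-last face kills one of the two factors, so `p u` is a degenerate Moore element whose
boundary is the product of the last faces. Every defect below is obtained from a choice of `p` and
`u`. -/
theorem mem_relations_of_complementary_faces (n : ℕ) {p u : E _⦋n + 3⦌}
    (hpD : p ∈ D conv E (n + 3)) (huD : u ∈ D conv E (n + 3)) (j : Fin (n + 3))
    (hp : ∀ i, i ≠ j → face E (n + 2) i.castSucc p = 0)
    (hu : face E (n + 2) j.castSucc u = 0) {z : NE E (n + 2)}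
    (hz : (z : E _⦋n + 2⦌) =
      face E (n + 2) (Fin.last (n + 3)) p * face E (n + 2) (Fin.last (n + 3)) u) :
    z ∈ relations conv E (n + 2) := by
  have h : z = NEd E (n + 2) ⟨p * u, mul_mem_NE_of_complementary_faces E (n + 2) j hp hu⟩ :=
    Subtype.ext (by rw [hz, NEd_coe, map_mul])
  rw [h]
  exact boundary_mem_relations conv E n (mul_mem_D conv E _ hpD huD)

/-- The alternating sums `± (sₙ x - sₙ₋₁ x + ⋯ ± sⱼ x)`, for `x ∈ NE_n`: of their faces other than
the last one only `dⱼ` is nontrivial. -/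
theorem exists_degenerate_with_one_face (n : ℕ) {x : E _⦋n + 1⦌} (hx : x ∈ NE E (n + 1))
    (j : Fin (n + 2)) :
    ∃ p ∈ D conv E (n + 2),
      (∀ i : Fin (n + 2), face E (n + 1) i.castSucc p = if i = j then x else 0) ∧
      (face E (n + 1) (Fin.last (n + 2)) p - x ∈ D conv E (n + 1) ∨
        face E (n + 1) (Fin.last (n + 2)) p + x ∈ D conv E (n + 1)) := by
  induction j using Fin.reverseInduction with
  | last =>
    refine ⟨_, degen_mem_D conv E (n + 1) (Fin.last (n + 1)) x, fun i => ?_, Or.inl ?_⟩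
    · rw [face_degen_of_mem_NE E (n + 1) hx]
      congr 1
      have := i.2
      simp only [Fin.val_last, eq_iff_iff, or_iff_left_iff_imp]
      omega
    · rw [lastFace_degen_last, sub_self]
      exact zero_mem _
  | cast j ih =>
    obtain ⟨p, hp, hf, hl⟩ := ih
    -- The non-last faces of `s_j x` equal to `x` are `d_j` and `d_{j+1}`; subtracting the previous
    -- element cancels the second.
    refine ⟨degen E (n + 1) j.castSucc x - p, sub_mem (degen_mem_D ..) hp, fun i => ?_, ?_⟩
    · rw [map_sub, hf, face_degen_of_mem_NE E (n + 1) hx]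
      simp only [Fin.ext_iff, Fin.val_castSucc, Fin.val_succ]
      by_cases h1 : i.val = j.val
      · simp [h1]
      · by_cases h2 : i.val = j.val + 1 <;> simp [h1, h2]
    -- The last face of `s_j x` is degenerate, so modulo `D` only the sign of the previous last face
    -- changes.
    · rw [map_sub, lastFace_degen]
      have hj := degen_mem_D conv E n j (face E n (Fin.last (n + 1)) x)
      rcases hl with hl | hl
      · right
        convert sub_mem hj hl using 1
        abel
      · left
        convert sub_mem hj hl using 1
        abel

/-- The alternating sum `p` attached to `x` and `j` has last face `± x` modulo `D`. Since the last
face of `u` is also in `D`, the boundary of `p u` agrees with `±` the wanted product up to an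
element of `D`, which is divided out from degree 3 on. -/
theorem mul_lastFace_mem_relations (n : ℕ) (x : NE E (n + 3)) {u : E _⦋n + 4⦌}
    (hu : u ∈ D conv E (n + 4))
    (hu' : face E (n + 3) (Fin.last (n + 4)) u ∈ D conv E (n + 3)) (j : Fin (n + 4))
    (hj : face E (n + 3) j.castSucc u = 0) :
    mulNE E (n + 3) (face E (n + 3) (Fin.last (n + 4)) u) x ∈ relations conv E (n + 3) := by
  obtain ⟨p, hp, hf, hl⟩ := exists_degenerate_with_one_face conv E (n + 2) x.2 j
  have hf' : ∀ i, i ≠ j → face E (n + 3) i.castSucc p = 0 := fun i hi => by rw [hf, if_neg hi]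
  have hb := boundary_mem_relations conv E (n + 1)
    (w := ⟨p * u, mul_mem_NE_of_complementary_faces E (n + 3) j hf' hj⟩)
    (mul_mem_D conv E _ hp hu)
  rcases hl with hl | hl
  · rw [← Submodule.sub_mem_iff_right _ hb]
    refine D_mem_relations conv E n ?_
    convert mul_mem_D conv E _ hl hu' using 1
    simp only [AddSubgroupClass.coe_sub, NEd_coe, mulNE_coe, map_mul, sub_mul]
    rw [mul_comm (x : E _⦋n + 3⦌)]
  · rw [← Submodule.add_mem_iff_right _ hb]
    refine D_mem_relations conv E n ?_
    convert mul_mem_D conv E _ hl hu' using 1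
    simp only [NonUnitalSubalgebra.coe_add, NEd_coe, mulNE_coe, map_mul, add_mul]
    rw [mul_comm (x : E _⦋n + 3⦌)]

/-- With `s` the top degeneracy and `s'` the one below it, this is the boundary of `s x (s x' - s'
x')`. In degree 2 it is the Peiffer identity `∂₂(x') · x = x' x`. -/
theorem mul_mulNE_sub_mem_relations (n : ℕ) (x x' : NE E (n + 2)) :
    mulNE E (n + 2) (x' - degen E (n + 1) (Fin.last (n + 1)) (NEd E (n + 1) x')) x ∈
      relations conv E (n + 2) := by
  refine mem_relations_of_complementary_faces conv E n
    (degen_mem_D conv E (n + 2) (Fin.last (n + 2)) x)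
    (sub_mem (degen_mem_D conv E (n + 2) (Fin.last (n + 2)) x')
      (degen_mem_D conv E (n + 2) (Fin.last (n + 1)).castSucc x')) (Fin.last (n + 2))
    (fun i hi => ?_) ?_ ?_
  · rw [face_degen_of_mem_NE E _ x.2, if_neg]
    have := i.2
    simp only [hi, Fin.val_last, false_or]
    omega
  · rw [map_sub, face_degen_of_mem_NE E _ x'.2, face_degen_of_mem_NE E _ x'.2, if_pos (by simp),
      if_pos (by simp), sub_self]
  · rw [map_sub, lastFace_degen_last, lastFace_degen_last, lastFace_degen, mul_comm]
    rfl

theorem mul_mem_relations (n : ℕ) (x x' : NE E (n + 3)) :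
    x * x' ∈ relations conv E (n + 3) := by
  have h1 := mul_mulNE_sub_mem_relations conv E (n + 1) x' x
  -- Writing `x = (x - s ∂x) + s ∂x` leaves the second term. Here `u` is a double top degeneracy of
  -- `∂x`; `d₀` commutes past both degeneracies and kills `∂x`.
  have h2 := mul_lastFace_mem_relations conv E n x'
    (u := degen E (n + 3) (Fin.last (n + 3)) (degen E (n + 2) (Fin.last (n + 2)) (NEd E (n + 2) x)))
    (degen_mem_D ..) (by rw [lastFace_degen_last]; exact degen_mem_D ..) 0 (by
      have ha := face_degen_of_lt E (n + 2) (i := 0) (j := Fin.last (n + 2)) (Fin.zero_le _)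
        (degen E (n + 2) (Fin.last (n + 2)) (NEd E (n + 2) x))
      have hb := face_degen_of_lt E (n + 1) (i := 0) (j := Fin.last (n + 1)) (Fin.zero_le _)
        (NEd E (n + 2) x)
      have hc : face E (n + 1) 0 (NEd E (n + 2) x : E _⦋n + 2⦌) = 0 := (NEd E (n + 2) x).2 0
      rw [hc, map_zero] at hb
      refine ha.trans (Eq.trans (congrArg _ hb) (map_zero _)))
  rw [lastFace_degen_last] at h2
  convert add_mem h1 h2 using 1
  ext
  simp only [NonUnitalSubalgebra.coe_add, NonUnitalSubalgebra.coe_mul, mulNE_coe, ← add_mul,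
    sub_add_cancel]

/-- The cut at 0 gives `d₀ y = 0`, and consecutive cuts act equally modulo relations. The upper
bound for `j` is the cut beyond all vertices, which gives the action of `∂y`. -/
theorem cut_mul_mem_relations (n : ℕ) (x : NE E (n + 3)) (y : NE E 1) {j : ℕ} (hj : j ≤ n + 4) :
    mulNE E (n + 3) (cut E (n + 3) j y) x ∈ relations conv E (n + 3) := by
  induction j with
  | zero =>
    rw [cut_zero, show face E 0 0 (y : E _⦋1⦌) = 0 from y.2 0, map_zero, ← mulNEₗ_apply,
      map_zero]
    exact zero_mem _
  | succ j ih =>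
    have hj' : j < n + 4 := by omega
    have hl : face E (n + 3) (Fin.last (n + 4)) (cut E (n + 4) j y - cut E (n + 4) (j + 1) y) =
        cut E (n + 3) j y - cut E (n + 3) (j + 1) y := by
      rw [map_sub, face_cut, face_cut, Fin.val_last, if_neg (by omega), if_neg (by omega)]
    have h := mul_lastFace_mem_relations conv E n x (u := cut E (n + 4) j y - cut E (n + 4) (j + 1) y)
      (sub_mem (cut_mem_D ..) (cut_mem_D ..))
      (by rw [hl]; exact sub_mem (cut_mem_D ..) (cut_mem_D ..)) ⟨j, hj'⟩ (by
        rw [map_sub, face_cut, face_cut, if_neg (by simp), if_pos (by simp), Nat.add_sub_cancel,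
          sub_self])
    rw [hl, ← mulNEₗ_apply, map_sub, LinearMap.sub_apply] at h
    exact (Submodule.sub_mem_iff_right _ (ih (by omega))).1 h

theorem boundary_act_mem_relations (n : ℕ) (x : NE E (n + 3)) (y : NE E 1) :
    mulNE E (n + 3) (totalDegen E (n + 3) (NEd E 0 y)) x ∈ relations conv E (n + 3) := by
  have h := cut_mul_mem_relations conv E n x y le_rfl
  rwa [cut_succ] at h

/-! ### Compatibility of the relations with actions, products, boundaries and morphisms. -/

theorem mulNE_mem_relations (n : ℕ) {a : E _⦋n + 2⦌} (ha : 3 ≤ n + 2 → a ∈ D conv E (n + 2))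
    {b : E _⦋n + 3⦌} (hb : b ∈ D conv E (n + 3)) (hab : face E (n + 2) (Fin.last (n + 3)) b = a)
    {x : NE E (n + 2)} (hx : x ∈ relations conv E (n + 2)) :
    mulNE E (n + 2) a x ∈ relations conv E (n + 2) := by
  refine relations_le conv E n (M := (relations conv E (n + 2)).comap (mulNEₗ E (n + 2) a))
    (fun hn x hx => ?_) (fun w hw => ?_) hx
  · obtain ⟨n, rfl⟩ : ∃ m, n = m + 1 := ⟨n - 1, by omega⟩
    exact D_mem_relations conv E n (mul_mem_D conv E _ (ha hn) hx)
  -- As `b` is a degenerate lift of `a` along the last face, `a ∂w = ∂(b w)` with `b w` again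
  -- degenerate.
  · have h := boundary_mem_relations conv E n (w := mulNE E (n + 3) b w) (mul_mem_D conv E _ hb hw)
    have h' : NEd E (n + 2) (mulNE E (n + 3) b w) = mulNE E (n + 2) a (NEd E (n + 2) w) :=
      Subtype.ext (by rw [NEd_coe, mulNE_coe, map_mul, hab]; rfl)
    rwa [h'] at h

theorem act_mem_relations (n : ℕ) (r : E _⦋0⦌) {x : NE E n} (hx : x ∈ relations conv E n) :
    mulNE E n (totalDegen E n r) x ∈ relations conv E n := by
  match n, x, hx with
  | 0, x, hx =>
    rw [(Submodule.mem_bot k).1 hx, ← mulNEₗ_apply, map_zero]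
    exact zero_mem _
  | 1, x, hx =>
    rw [(Submodule.mem_bot k).1 hx, ← mulNEₗ_apply, map_zero]
    exact zero_mem _
  | n + 2, x, hx =>
    exact mulNE_mem_relations conv E n (fun _ => totalDegen_mem_D ..)
      (totalDegen_mem_D conv E (n + 2) r) (face_totalDegen ..) hx

theorem act₁_mem_relations (y : E _⦋1⦌) {x : NE E 2} (hx : x ∈ relations conv E 2) :
    mulNE E 2 (degen E 1 1 y) x ∈ relations conv E 2 :=
  mulNE_mem_relations conv E 0 (by omega) (degen_mem_D conv E 2 2 _) (lastFace_degen_last E 2 _) hx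

/-- In degree 2 any `a` lifts to the degenerate element `s₂ a`; from degree 3 on every product of
Moore elements is already a relation. -/
theorem mul_mem_relations_of_right (n : ℕ) (a : NE E n) {x : NE E n}
    (hx : x ∈ relations conv E n) : a * x ∈ relations conv E n := by
  match n, a, x, hx with
  | 0, a, x, hx =>
    rw [(Submodule.mem_bot k).1 hx, mul_zero]
    exact zero_mem _
  | 1, a, x, hx =>
    rw [(Submodule.mem_bot k).1 hx, mul_zero]
    exact zero_mem _
  | 2, a, x, hx =>
    exact mulNE_mem_relations conv E 0 (by omega) (degen_mem_D conv E 2 2 _)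
      (lastFace_degen_last E 2 (a : E _⦋2⦌)) hx
  | n + 3, a, x, hx => exact mul_mem_relations conv E n a x

theorem NEd_NEd (n : ℕ) (x : NE E (n + 2)) : NEd E n (NEd E (n + 1) x) = 0 := by
  refine Subtype.ext ((face_face E n (i := Fin.last (n + 1)) (j := Fin.last (n + 1)) le_rfl
    (x : E _⦋n + 2⦌)).trans ?_)
  rw [x.2, map_zero]
  rfl

theorem NEd_mem_relations (n : ℕ) {x : NE E (n + 1)} (hx : x ∈ relations conv E (n + 1)) :
    NEd E n x ∈ relations conv E n := by
  match n, x, hx with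
  | 0, x, hx =>
    rw [(Submodule.mem_bot k).1 hx, map_zero]
    exact zero_mem _
  | n + 1, x, hx =>
    refine relations_le conv E n (M := (relations conv E (n + 1)).comap (NEd E (n + 1)))
      (fun hn x hx => ?_) (fun w hw => ?_) hx
    · obtain ⟨n, rfl⟩ : ∃ m, n = m + 1 := ⟨n - 1, by omega⟩
      exact boundary_mem_relations conv E n hx
    · rw [Submodule.mem_comap, NEd_NEd]
      exact zero_mem _

theorem NEd_NEmap {E' : SimpAlg.{u, v} k} (f : E ⟶ E') (n : ℕ) (x : NE E (n + 1)) :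
    NEd E' n (NEmap f (n + 1) x) = NEmap f n (NEd E n x) :=
  Subtype.ext (face_component f n _ _)

/-- `NEmap` as a linear map. -/
def NEmapₗ {E' : SimpAlg.{u, v} k} (f : E ⟶ E') (n : ℕ) : NE E n →ₗ[k] NE E' n where
  toFun := NEmap f n
  map_add' x y := Subtype.ext (map_add (component f n) (x : E _⦋n⦌) y)
  map_smul' c x := Subtype.ext (map_smul (component f n) c (x : E _⦋n⦌))

theorem NEmap_mem_relations {E' : SimpAlg.{u, v} k} (f : E ⟶ E') (n : ℕ) {x : NE E n}
    (hx : x ∈ relations conv E n) : NEmap f n x ∈ relations conv E' n := by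
  match n, x, hx with
  | 0, x, hx =>
    rw [(Submodule.mem_bot k).1 hx, show NEmap f 0 0 = 0 from map_zero (NEmapₗ E f 0)]
    exact zero_mem _
  | 1, x, hx =>
    rw [(Submodule.mem_bot k).1 hx, show NEmap f 1 0 = 0 from map_zero (NEmapₗ E f 1)]
    exact zero_mem _
  | n + 2, x, hx =>
    refine relations_le conv E n (M := (relations conv E' (n + 2)).comap (NEmapₗ E f (n + 2)))
      (fun hn x hx => ?_) (fun w hw => ?_) hx
    · obtain ⟨n, rfl⟩ : ∃ m, n = m + 1 := ⟨n - 1, by omega⟩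
      exact D_mem_relations conv E' n (component_mem_D conv E f _ hx)
    · have h := boundary_mem_relations conv E' n (w := NEmap f (n + 3) w)
        (component_mem_D conv E f _ hw)
      rwa [NEd_NEmap] at h

/-! ### The three boundaries behind the Peiffer lifting axioms. -/

theorem mul_cut_sub_cut_mem_relations (x : NE E 2) (y : NE E 1) :
    mulNE E 2 (cut E 2 2 y - cut E 2 3 y) x ∈ relations conv E 2 := by
  -- Since the cuts in degree 2 are `s₀ y` and `s₀² ∂y`, this identifies their actions on `x` modulo
  -- relations.
  refine mem_relations_of_complementary_faces conv E 0 (degen_mem_D conv E 2 2 x)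
    (sub_mem (cut_mem_D conv E 1 2 y) (cut_mem_D conv E 1 3 y)) 2 (fun i hi => ?_) ?_ ?_
  · rw [face_degen_of_mem_NE E 2 x.2, if_neg]
    fin_cases i <;> simp at hi ⊢
  · rw [map_sub, face_cut, face_cut]
    simp
  · have h := lastFace_degen_last E 2 (x : E _⦋2⦌)
    refine Eq.trans ?_ (congrArg (· * _) h.symm)
    rw [map_sub, face_cut, face_cut, mul_comm]
    rfl

/-- The last faces are `x - s₁ ∂x` and `s₁ y - s₀ y`, and expanding their product gives the
difference. -/
theorem mul_degen_sub_degen_mem_relations (x : NE E 2) (y : NE E 1) :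
    mulNE E 2 (degen E 1 1 y - degen E 1 0 y) x - peiffer E (NEd E 1 x) y ∈
      relations conv E 2 := by
  refine mem_relations_of_complementary_faces conv E 0
    (sub_mem (degen_mem_D conv E 2 2 x) (degen_mem_D conv E 2 1 x))
    (sub_mem (cut_mem_D conv E 1 1 y) (cut_mem_D conv E 1 2 y)) 1 (fun i hi => ?_) ?_ ?_
  · rw [map_sub, face_degen_of_mem_NE E 2 x.2, face_degen_of_mem_NE E 2 x.2]
    fin_cases i <;> simp at hi ⊢
  · rw [map_sub, face_cut, face_cut]
    simp
  · have h := lastFace_degen_last E 2 (x : E _⦋2⦌)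
    have h' := lastFace_degen E 1 1 (x : E _⦋2⦌)
    have e : face E 2 (Fin.last 3) (degen E 2 2 x - degen E 2 1 x) =
        x - degen E 1 1 (NEd E 1 x) := by
      rw [map_sub]
      exact congrArg₂ _ h h'
    refine Eq.trans ?_ (congrArg (· * _) e.symm)
    rw [map_sub, face_cut, face_cut, if_neg (by simp), if_neg (by simp), sub_mul,
      ← degen_one_one, ← degen_one_zero, mul_comm (x : E _⦋2⦌)]
    rfl

/-- The full alternating sum `s₂ x - s₁ x + s₀ x` has only `d₀` nontrivial among non-last faces. It
pairs with the cut of `y` at 1, whose `d₀` vanishes because `d₀ y = 0`. -/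
theorem act₁_sub_peiffer_mem_relations (x : NE E 2) (y : NE E 1) :
    mulNE E 2 (degen E 1 1 y) x - peiffer E y (NEd E 1 x) ∈ relations conv E 2 := by
  refine mem_relations_of_complementary_faces conv E 0
    (add_mem (sub_mem (degen_mem_D conv E 2 2 x) (degen_mem_D conv E 2 1 x))
      (degen_mem_D conv E 2 0 x))
    (cut_mem_D conv E 1 1 y) 0 (fun i hi => ?_) ?_ ?_
  · rw [map_add, map_sub, face_degen_of_mem_NE E 2 x.2, face_degen_of_mem_NE E 2 x.2,
      face_degen_of_mem_NE E 2 x.2]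
    fin_cases i <;> simp at hi ⊢
  · rw [face_cut, if_pos (by simp), cut_zero, show face E 0 0 (y : E _⦋1⦌) = 0 from y.2 0,
      map_zero]
  · have h := lastFace_degen_last E 2 (x : E _⦋2⦌)
    have h' := lastFace_degen E 1 1 (x : E _⦋2⦌)
    have h'' := lastFace_degen E 1 0 (x : E _⦋2⦌)
    have e : face E 2 (Fin.last 3) (degen E 2 2 x - degen E 2 1 x + degen E 2 0 x) =
        x - degen E 1 1 (NEd E 1 x) + degen E 1 0 (NEd E 1 x) := by
      rw [map_add, map_sub]
      exact congrArg₂ _ (congrArg₂ _ h h') h''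
    refine Eq.trans ?_ (congrArg (· * _) e.symm)
    rw [face_cut, if_neg (by simp), ← degen_one_one]
    simp only [AddSubgroupClass.coe_sub, mulNE_coe, peiffer]
    rw [mul_comm _ (degen E 1 1 (y : E _⦋1⦌)), mul_add, mul_sub, mul_sub]
    abel

end Relations

/-! ### Quotients of non-unital algebras and induced bilinear maps. -/

section Quotient

variable {k : Type u} [CommRing k]

/-- The bilinear map induced on quotients by a bilinear map compatible with the submodules that
are divided out. -/
def quotientBilin {M N P : Type*} [AddCommGroup M] [Module k M] [AddCommGroup N] [Module k N]
    [AddCommGroup P] [Module k P] (I : Submodule k M) (J : Submodule k N) (K : Submodule k P)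
    (φ : M →ₗ[k] N →ₗ[k] P) (hI : ∀ x ∈ I, ∀ y, φ x y ∈ K) (hJ : ∀ x, ∀ y ∈ J, φ x y ∈ K) :
    M ⧸ I →ₗ[k] N ⧸ J →ₗ[k] P ⧸ K :=
  I.liftQ
    { toFun := fun x => J.mapQ K (φ x) (hJ x)
      map_add' := fun x x' => by
        ext y
        simp
      map_smul' := fun c x => by
        ext y
        simp }
    (fun x hx => by
      rw [LinearMap.mem_ker]
      ext y
      simpa using hI x hx y)

/-- The quotient of a non-unital commutative `k`-algebra by an absorbing submodule. -/
abbrev quotientRing {A : Type v} [NonUnitalCommRing A] [Module k A] [IsScalarTower k A A]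
    [SMulCommClass k A A] (I : Submodule k A) (h : ∀ a, ∀ x ∈ I, a * x ∈ I) :
    NonUnitalCommRing (A ⧸ I) :=
  let m : A ⧸ I →ₗ[k] A ⧸ I →ₗ[k] A ⧸ I :=
    quotientBilin I I I (LinearMap.mul k A)
      (fun x hx y => by rw [LinearMap.mul_apply', mul_comm]; exact h y x hx) h
  { (inferInstance : AddCommGroup (A ⧸ I)) with
    mul := fun x y => m x y
    left_distrib := fun x y z => map_add (m x) y z
    right_distrib := fun x y z => by
      change m (x + y) z = m x z + m y z
      rw [map_add, LinearMap.add_apply]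
    zero_mul := fun x => by
      change m 0 x = 0
      rw [map_zero, LinearMap.zero_apply]
    mul_zero := fun x => map_zero (m x)
    mul_assoc := by
      rintro ⟨x⟩ ⟨y⟩ ⟨z⟩
      exact congrArg (Submodule.Quotient.mk (p := I)) (mul_assoc x y z)
    mul_comm := by
      rintro ⟨x⟩ ⟨y⟩
      exact congrArg (Submodule.Quotient.mk (p := I)) (mul_comm x y) }

/-- The quotient of a non-unital commutative `k`-algebra by an absorbing submodule, as an object
of `Alg`. -/
def quotientAlg {A : Type v} [NonUnitalCommRing A] [Module k A] [IsScalarTower k A A]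
    [SMulCommClass k A A] (I : Submodule k A) (h : ∀ a, ∀ x ∈ I, a * x ∈ I) : CAlg.{u, v} k :=
  letI := quotientRing I h
  { carrier := A ⧸ I
    ring := quotientRing I h
    module := Submodule.Quotient.module I
    isScalarTower := ⟨by
      rintro c ⟨x⟩ ⟨y⟩
      exact congrArg (Submodule.Quotient.mk (p := I)) (smul_mul_assoc c x y)⟩
    smulCommClass := ⟨by
      rintro c ⟨x⟩ ⟨y⟩
      exact congrArg (Submodule.Quotient.mk (p := I)) (mul_smul_comm c x y).symm⟩ }

end Quotient

/-! ### The 2-crossed complex of a simplicial algebra, and functoriality. -/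

section Functor

variable {k : Type u} [CommRing k] (conv : DegenerateConvention) (E : SimpAlg.{u, v} k)

/-- The terms of the 2-crossed complex of a simplicial algebra. -/
def term (n : ℕ) : CAlg.{u, v} k :=
  quotientAlg (relations conv E n) fun a _ hx => mul_mem_relations_of_right conv E n a hx

/-- The class in `C_n` of an element of `NE_n`. -/
def cls (n : ℕ) : NE E n →ₗ[k] term conv E n := (relations conv E n).mkQ

theorem cls_surjective (n : ℕ) : Function.Surjective (cls conv E n) :=
  Submodule.mkQ_surjective _

theorem cls_mul (n : ℕ) (x y : NE E n) : cls conv E n (x * y) = cls conv E n x * cls conv E n y :=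
  rfl

theorem cls_eq {n : ℕ} {x y : NE E n} (h : x - y ∈ relations conv E n) :
    cls conv E n x = cls conv E n y :=
  (Submodule.Quotient.eq _).2 h

theorem cls_eq_zero {n : ℕ} {x : NE E n} (h : x ∈ relations conv E n) : cls conv E n x = 0 :=
  (Submodule.Quotient.mk_eq_zero _).2 h

/-- A linear map `NE_n → NE'_m` that respects products and relations induces a homomorphism. -/
def termHom {E E' : SimpAlg.{u, v} k} {n m : ℕ} (f : NE E n →ₗ[k] NE E' m)
    (hf : ∀ x y, f (x * y) = f x * f y)
    (h : ∀ x ∈ relations conv E n, f x ∈ relations conv E' m) :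
    term conv E n →ₙₐ[k] term conv E' m :=
  let g : term conv E n →ₗ[k] term conv E' m := (relations conv E n).mapQ (relations conv E' m) f h
  { toFun := g
    map_smul' := fun c x => map_smul g c x
    map_zero' := map_zero g
    map_add' := map_add g
    map_mul' := by
      intro a b
      obtain ⟨x, rfl⟩ := cls_surjective conv E n a
      obtain ⟨y, rfl⟩ := cls_surjective conv E n b
      exact congrArg (cls conv E' m) (hf x y) }

/-- The boundary `C_{n+1} → C_n`. -/
def termBoundary (n : ℕ) : term conv E (n + 1) →ₙₐ[k] term conv E n :=
  termHom conv (NEd E n) (fun _ _ => Subtype.ext (map_mul (face E n _) _ _))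
    (fun _ hx => NEd_mem_relations conv E n hx)

theorem termBoundary_cls (n : ℕ) (x : NE E (n + 1)) :
    termBoundary conv E n (cls conv E (n + 1) x) = cls conv E n (NEd E n x) := rfl

/-- The action of `C_0` on `C_n`. -/
def termAct (n : ℕ) : term conv E 0 →ₗ[k] term conv E n →ₗ[k] term conv E n :=
  quotientBilin (relations conv E 0) (relations conv E n) (relations conv E n)
    ((mulNEₗ E n).comp
      ((totalDegen E n : E _⦋0⦌ →ₗ[k] E _⦋n⦌).comp (NE E 0).toSubmodule.subtype))
    (fun x hx y => by
      rw [(Submodule.mem_bot k).1 hx, map_zero, LinearMap.zero_apply]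
      exact zero_mem _)
    (fun r _ hx => act_mem_relations conv E n r hx)

theorem termAct_cls (n : ℕ) (r : NE E 0) (x : NE E n) :
    termAct conv E n (cls conv E 0 r) (cls conv E n x) =
      cls conv E n (mulNE E n (totalDegen E n r) x) := rfl

/-- The action of `C_1` on `C_2`. -/
def termAct₁ : term conv E 1 →ₗ[k] term conv E 2 →ₗ[k] term conv E 2 :=
  quotientBilin (relations conv E 1) (relations conv E 2) (relations conv E 2)
    ((mulNEₗ E 2).comp ((degen E 1 1 : E _⦋1⦌ →ₗ[k] E _⦋2⦌).comp (NE E 1).toSubmodule.subtype))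
    (fun x hx y => by
      rw [(Submodule.mem_bot k).1 hx, map_zero, LinearMap.zero_apply]
      exact zero_mem _)
    (fun y _ hx => act₁_mem_relations conv E y hx)

theorem termAct₁_cls (y : NE E 1) (x : NE E 2) :
    termAct₁ conv E (cls conv E 1 y) (cls conv E 2 x) =
      cls conv E 2 (mulNE E 2 (degen E 1 1 y) x) := rfl

/-- `peiffer` as a bilinear map. -/
def peifferₗ : NE E 1 →ₗ[k] NE E 1 →ₗ[k] NE E 2 :=
  LinearMap.mk₂ k (peiffer E)
    (fun x y z => Subtype.ext (by simp [peiffer, add_mul]))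
    (fun c x y => Subtype.ext (by simp [peiffer, smul_mul_assoc]))
    (fun x y z => Subtype.ext (by simp [peiffer, mul_sub, mul_add]; abel))
    (fun c x y => Subtype.ext (by simp [peiffer, ← smul_sub, mul_smul_comm]))

/-- The Peiffer lifting. -/
def termLift : term conv E 1 →ₗ[k] term conv E 1 →ₗ[k] term conv E 2 :=
  quotientBilin (relations conv E 1) (relations conv E 1) (relations conv E 2) (peifferₗ E)
    (fun x hx y => by
      rw [(Submodule.mem_bot k).1 hx, map_zero, LinearMap.zero_apply]
      exact zero_mem _)
    (fun x y hy => by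
      rw [(Submodule.mem_bot k).1 hy, map_zero]
      exact zero_mem _)

theorem termLift_cls (y₀ y₁ : NE E 1) :
    termLift conv E (cls conv E 1 y₀) (cls conv E 1 y₁) = cls conv E 2 (peiffer E y₀ y₁) := rfl

theorem termAct₁_boundary (x x' : term conv E 2) :
    termAct₁ conv E (termBoundary conv E 1 x) x' = x * x' := by
  obtain ⟨x, rfl⟩ := cls_surjective conv E 2 x
  obtain ⟨x', rfl⟩ := cls_surjective conv E 2 x'
  rw [termBoundary_cls, termAct₁_cls, ← cls_mul]
  refine (cls_eq conv E ?_).symm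
  convert mul_mulNE_sub_mem_relations conv E 0 x' x using 1
  exact Subtype.ext (sub_mul _ _ (x' : E _⦋2⦌)).symm

theorem termLift_boundary_left (x : term conv E 2) (y : term conv E 1) :
    termLift conv E (termBoundary conv E 1 x) y =
      termAct₁ conv E y x - termAct conv E 2 (termBoundary conv E 0 y) x := by
  obtain ⟨x, rfl⟩ := cls_surjective conv E 2 x
  obtain ⟨y, rfl⟩ := cls_surjective conv E 1 y
  rw [termBoundary_cls, termBoundary_cls, termLift_cls, termAct₁_cls, termAct_cls, ← map_sub]
  refine (cls_eq conv E ?_).symm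
  -- The terms in `s₀ y` cancel, leaving `(s₁ y - s₀² ∂y) x` minus the lifting of `∂x` and `y`.
  convert add_mem (mul_degen_sub_degen_mem_relations conv E x y)
    (mul_cut_sub_cut_mem_relations conv E x y) using 1
  rw [cut_succ E 2, ← degen_one_zero]
  refine Subtype.ext ?_
  simp only [AddSubgroupClass.coe_sub, NonUnitalSubalgebra.coe_add, mulNE_coe, sub_mul, NEd_coe]
  have : face E 0 1 (y : E _⦋1⦌) = face E 0 (Fin.last 1) y := rfl
  rw [this]
  abel

theorem termLift_boundary_right (y : term conv E 1) (x : term conv E 2) :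
    termLift conv E y (termBoundary conv E 1 x) = termAct₁ conv E y x := by
  obtain ⟨x, rfl⟩ := cls_surjective conv E 2 x
  obtain ⟨y, rfl⟩ := cls_surjective conv E 1 y
  exact (cls_eq conv E (act₁_sub_peiffer_mem_relations conv E x y)).symm

theorem termBoundary_boundary (n : ℕ) (x : term conv E (n + 2)) :
    termBoundary conv E n (termBoundary conv E (n + 1) x) = 0 := by
  obtain ⟨x, rfl⟩ := cls_surjective conv E (n + 2) x
  rw [termBoundary_cls, termBoundary_cls, NEd_NEd, map_zero]

theorem termLift_mul (y₀ y₁ y₂ : term conv E 1) :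
    termLift conv E y₀ (y₁ * y₂) = termLift conv E (y₀ * y₁) y₂ +
      termAct conv E 2 (termBoundary conv E 0 y₂) (termLift conv E y₀ y₁) := by
  obtain ⟨y₀, rfl⟩ := cls_surjective conv E 1 y₀
  obtain ⟨y₁, rfl⟩ := cls_surjective conv E 1 y₁
  obtain ⟨y₂, rfl⟩ := cls_surjective conv E 1 y₂
  rw [← cls_mul, ← cls_mul, termBoundary_cls, termLift_cls, termLift_cls, termLift_cls,
    termAct_cls, ← map_add]
  refine cls_eq conv E ?_
  -- On representatives the difference of the two liftings is exactly `s₀ y₂` times the lifting of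
  -- `y₀` and `y₁`; it remains to replace `s₀ y₂` by `s₀² ∂y₂`.
  convert mul_cut_sub_cut_mem_relations conv E (peiffer E y₀ y₁) y₂ using 1
  rw [cut_succ E 2, ← degen_one_zero]
  refine Subtype.ext ?_
  simp only [AddSubgroupClass.coe_sub, NonUnitalSubalgebra.coe_add, NonUnitalSubalgebra.coe_mul,
    mulNE_coe, NEd_coe, peiffer, map_mul]
  have : face E 0 1 (y₂ : E _⦋1⦌) = face E 0 (Fin.last 1) y₂ := rfl
  rw [this]
  generalize totalDegen E 2 _ = t
  simp only [mul_sub, mul_comm, mul_left_comm]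
  abel

/-- The 2-crossed complex of a simplicial algebra. -/
def twoCrossedComplex : TwoCrsComp.{u, v} k where
  C := term conv E
  d := termBoundary conv E
  d_d := termBoundary_boundary conv E
  act := termAct conv E
  act_zero r x := by
    obtain ⟨r, rfl⟩ := cls_surjective conv E 0 r
    obtain ⟨x, rfl⟩ := cls_surjective conv E 0 x
    rw [termAct_cls, totalDegen_zero]
    rfl
  mul_act n r s x := by
    obtain ⟨r, rfl⟩ := cls_surjective conv E 0 r
    obtain ⟨s, rfl⟩ := cls_surjective conv E 0 s
    obtain ⟨x, rfl⟩ := cls_surjective conv E n x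
    rw [← cls_mul, termAct_cls, termAct_cls, termAct_cls]
    refine congrArg (cls conv E n) (Subtype.ext ?_)
    simp only [NonUnitalSubalgebra.coe_mul, mulNE_coe, map_mul, mul_assoc]
  act_mul n r x y := by
    obtain ⟨r, rfl⟩ := cls_surjective conv E 0 r
    obtain ⟨x, rfl⟩ := cls_surjective conv E n x
    obtain ⟨y, rfl⟩ := cls_surjective conv E n y
    exact congrArg (cls conv E n) (Subtype.ext (mul_assoc _ (x : E _⦋n⦌) y).symm)
  d_act n r x := by
    obtain ⟨r, rfl⟩ := cls_surjective conv E 0 r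
    obtain ⟨x, rfl⟩ := cls_surjective conv E (n + 1) x
    rw [termAct_cls, termBoundary_cls, termBoundary_cls, termAct_cls]
    refine congrArg (cls conv E n) (Subtype.ext ?_)
    simp only [mulNE_coe, NEd_coe, map_mul, face_totalDegen]
  act₁ := termAct₁ conv E
  mul_act₁ y y' x := by
    obtain ⟨y, rfl⟩ := cls_surjective conv E 1 y
    obtain ⟨y', rfl⟩ := cls_surjective conv E 1 y'
    obtain ⟨x, rfl⟩ := cls_surjective conv E 2 x
    rw [← cls_mul, termAct₁_cls, termAct₁_cls, termAct₁_cls]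
    refine congrArg (cls conv E 2) (Subtype.ext ?_)
    simp only [NonUnitalSubalgebra.coe_mul, mulNE_coe, map_mul, mul_assoc]
  act₁_mul y x x' := by
    obtain ⟨y, rfl⟩ := cls_surjective conv E 1 y
    obtain ⟨x, rfl⟩ := cls_surjective conv E 2 x
    obtain ⟨x', rfl⟩ := cls_surjective conv E 2 x'
    exact congrArg (cls conv E 2) (Subtype.ext (mul_assoc _ (x : E _⦋2⦌) x').symm)
  act_act₁ r y x := by
    obtain ⟨r, rfl⟩ := cls_surjective conv E 0 r
    obtain ⟨y, rfl⟩ := cls_surjective conv E 1 y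
    obtain ⟨x, rfl⟩ := cls_surjective conv E 2 x
    rw [termAct_cls, termAct₁_cls, termAct₁_cls, termAct_cls]
    refine congrArg (cls conv E 2) (Subtype.ext ?_)
    simp only [mulNE_coe, map_mul, mul_assoc, degen_totalDegen]
  act₁_act r y x := by
    obtain ⟨r, rfl⟩ := cls_surjective conv E 0 r
    obtain ⟨y, rfl⟩ := cls_surjective conv E 1 y
    obtain ⟨x, rfl⟩ := cls_surjective conv E 2 x
    rw [termAct_cls, termAct₁_cls, termAct₁_cls, termAct_cls]
    exact congrArg (cls conv E 2) (Subtype.ext (mul_left_comm _ _ (x : E _⦋2⦌)))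
  d_act₁ y x := by
    obtain ⟨y, rfl⟩ := cls_surjective conv E 1 y
    obtain ⟨x, rfl⟩ := cls_surjective conv E 2 x
    rw [termAct₁_cls, termBoundary_cls, termBoundary_cls, ← cls_mul]
    refine congrArg (cls conv E 1) (Subtype.ext ?_)
    have h := lastFace_degen_last E 1 (y : E _⦋1⦌)
    simp only [NonUnitalSubalgebra.coe_mul, mulNE_coe, NEd_coe, map_mul]
    exact congrArg (· * _) h
  act₁_d := termAct₁_boundary conv E
  lift := termLift conv E
  d_lift y₀ y₁ := by
    obtain ⟨y₀, rfl⟩ := cls_surjective conv E 1 y₀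
    obtain ⟨y₁, rfl⟩ := cls_surjective conv E 1 y₁
    rw [termLift_cls, termBoundary_cls, termBoundary_cls, termAct_cls, ← cls_mul, ← map_sub]
    refine congrArg (cls conv E 1) (Subtype.ext ?_)
    have h₀ := lastFace_degen_last E 1 (y₀ : E _⦋1⦌)
    have h₁ := lastFace_degen_last E 1 (y₁ : E _⦋1⦌)
    have h := lastFace_degen E 0 0 (y₁ : E _⦋1⦌)
    have ht := degen_totalDegen E 0 0 (face E 0 (Fin.last 1) (y₁ : E _⦋1⦌))
    rw [totalDegen_zero] at ht
    rw [ht] at h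
    simp only [AddSubgroupClass.coe_sub, NonUnitalSubalgebra.coe_mul, mulNE_coe, NEd_coe, peiffer,
      map_mul, map_sub]
    refine (congrArg₂ (· * ·) h₀ (congrArg₂ (· - ·) h₁ h)).trans ?_
    rw [mul_sub, mul_comm _ (totalDegen E 1 _)]
  lift_d_d x₁ x₂ := by
    -- The `C₀` term drops out by `∂∂ = 0`, and the crossed module identity evaluates the rest.
    rw [termLift_boundary_left, termBoundary_boundary, map_zero, LinearMap.zero_apply, sub_zero,
      termAct₁_boundary, mul_comm]
  lift_mul := termLift_mul conv E
  lift_d_left := termLift_boundary_left conv E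
  lift_d_right := termLift_boundary_right conv E
  lift_act_left r y₀ y₁ := by
    obtain ⟨r, rfl⟩ := cls_surjective conv E 0 r
    obtain ⟨y₀, rfl⟩ := cls_surjective conv E 1 y₀
    obtain ⟨y₁, rfl⟩ := cls_surjective conv E 1 y₁
    rw [termAct_cls, termLift_cls, termLift_cls, termAct_cls]
    refine congrArg (cls conv E 2) (Subtype.ext ?_)
    simp only [mulNE_coe, peiffer, map_mul, mul_assoc, degen_totalDegen]
  lift_act_right r y₀ y₁ := by
    obtain ⟨r, rfl⟩ := cls_surjective conv E 0 r
    obtain ⟨y₀, rfl⟩ := cls_surjective conv E 1 y₀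
    obtain ⟨y₁, rfl⟩ := cls_surjective conv E 1 y₁
    rw [termAct_cls, termLift_cls, termLift_cls, termAct_cls]
    refine congrArg (cls conv E 2) (Subtype.ext ?_)
    simp only [mulNE_coe, peiffer, map_mul, degen_totalDegen, ← mul_sub]
    rw [mul_left_comm]
  act_d n hn y x := by
    obtain ⟨n, rfl⟩ : ∃ m, n = m + 3 := ⟨n - 3, by omega⟩
    obtain ⟨y, rfl⟩ := cls_surjective conv E 1 y
    obtain ⟨x, rfl⟩ := cls_surjective conv E (n + 3) x
    exact cls_eq_zero conv E (boundary_act_mem_relations conv E n x y)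
  mul_eq_zero n hn x x' := by
    obtain ⟨n, rfl⟩ : ∃ m, n = m + 3 := ⟨n - 3, by omega⟩
    obtain ⟨x, rfl⟩ := cls_surjective conv E (n + 3) x
    obtain ⟨x', rfl⟩ := cls_surjective conv E (n + 3) x'
    exact cls_eq_zero conv E (mul_mem_relations conv E n x x')

/-- The map `C_n → C'_n` induced by a morphism of simplicial algebras. -/
def termMap {E E' : SimpAlg.{u, v} k} (f : E ⟶ E') (n : ℕ) : term conv E n →ₙₐ[k] term conv E' n :=
  termHom conv (NEmapₗ E f n) (fun _ _ => Subtype.ext (map_mul (component f n) _ _))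
    (fun _ hx => NEmap_mem_relations conv E f n hx)

/-- The morphism of 2-crossed complexes induced by a morphism of simplicial algebras. -/
def twoCrossedMap {E E' : SimpAlg.{u, v} k} (f : E ⟶ E') :
    twoCrossedComplex conv E ⟶ twoCrossedComplex conv E' where
  f := termMap conv f
  f_d n x := by
    obtain ⟨x, rfl⟩ := cls_surjective conv E (n + 1) x
    exact congrArg (cls conv E' n) (NEd_NEmap E f n x).symm
  f_act n r x := by
    obtain ⟨r, rfl⟩ := cls_surjective conv E 0 r
    obtain ⟨x, rfl⟩ := cls_surjective conv E n x
    refine congrArg (cls conv E' n) (Subtype.ext ((map_mul (component f n) _ _).trans ?_))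
    exact congrArg (· * _) (totalDegen_component E f n (r : E _⦋0⦌)).symm
  f_act₁ y x := by
    obtain ⟨y, rfl⟩ := cls_surjective conv E 1 y
    obtain ⟨x, rfl⟩ := cls_surjective conv E 2 x
    refine congrArg (cls conv E' 2) (Subtype.ext ((map_mul (component f 2) _ _).trans ?_))
    exact congrArg (· * _) (degen_component E f 1 1 (y : E _⦋1⦌)).symm
  f_lift y₀ y₁ := by
    obtain ⟨y₀, rfl⟩ := cls_surjective conv E 1 y₀
    obtain ⟨y₁, rfl⟩ := cls_surjective conv E 1 y₁
    refine congrArg (cls conv E' 2) (Subtype.ext ((map_mul (component f 2) _ _).trans ?_))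
    rw [map_sub]
    exact congrArg₂ (· * ·) (degen_component E f 1 1 (y₀ : E _⦋1⦌)).symm
      (congrArg₂ (· - ·) (degen_component E f 1 1 (y₁ : E _⦋1⦌)).symm
        (degen_component E f 1 0 (y₁ : E _⦋1⦌)).symm)

/-- The functor from simplicial algebras to 2-crossed complexes. -/
def twoCrossedFunctor : SimpAlg.{u, v} k ⥤ TwoCrsComp.{u, v} k where
  obj := twoCrossedComplex conv
  map := twoCrossedMap conv
  map_id E := TwoCrsComp.Hom.ext <| funext fun n => NonUnitalAlgHom.ext fun x => by
    obtain ⟨x, rfl⟩ := cls_surjective conv E n x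
    rfl
  map_comp {E _ _} f g := TwoCrsComp.Hom.ext <| funext fun n => NonUnitalAlgHom.ext fun x => by
    obtain ⟨x, rfl⟩ := cls_surjective conv E n x
    rfl

end Functor

end TwoCrossed

theorem mainTheorem8 (k : Type u) [CommRing k] (conv : TwoCrossed.DegenerateConvention) :
    ∃ (F : TwoCrossed.SimpAlg.{u, v} k ⥤ TwoCrossed.TwoCrsComp.{u, v} k)
      (e : ∀ (E : TwoCrossed.SimpAlg.{u, v} k) (n : ℕ),
        (TwoCrossed.NE E n ⧸ TwoCrossed.relations conv E n) ≃ₗ[k] (F.obj E).C n),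
      -- the multiplication of `C_n` is induced by that of `NE_n`
      (∀ E n (x y : TwoCrossed.NE E n),
        e E n (Submodule.Quotient.mk x) * e E n (Submodule.Quotient.mk y) =
          e E n (Submodule.Quotient.mk (x * y))) ∧
      -- the boundary is induced by the differential of `NE`
      (∀ E n (x : TwoCrossed.NE E (n + 1)),
        (F.obj E).d n (e E (n + 1) (Submodule.Quotient.mk x)) =
          e E n (Submodule.Quotient.mk (TwoCrossed.NEd E n x))) ∧
      -- `C_0` acts on `C_n` by multiplication through `s₀ⁿ`
      (∀ E n (r : TwoCrossed.NE E 0) (x : TwoCrossed.NE E n),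
        (F.obj E).act n (e E 0 (Submodule.Quotient.mk r)) (e E n (Submodule.Quotient.mk x)) =
          e E n (Submodule.Quotient.mk
            (TwoCrossed.mulNE E n (TwoCrossed.totalDegen E n r) x))) ∧
      -- `C_1` acts on `C_2` by multiplication through `s₁`
      (∀ E (y : TwoCrossed.NE E 1) (x : TwoCrossed.NE E 2),
        (F.obj E).act₁ (e E 1 (Submodule.Quotient.mk y)) (e E 2 (Submodule.Quotient.mk x)) =
          e E 2 (Submodule.Quotient.mk
            (TwoCrossed.mulNE E 2 (TwoCrossed.degen E 1 1 y) x))) ∧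
      -- the Peiffer lifting is `{y₀ ⊗ y₁} = [s₁y₀ (s₁y₁ - s₀y₁)]`
      (∀ E (y₀ y₁ : TwoCrossed.NE E 1),
        (F.obj E).lift (e E 1 (Submodule.Quotient.mk y₀)) (e E 1 (Submodule.Quotient.mk y₁)) =
          e E 2 (Submodule.Quotient.mk (TwoCrossed.peiffer E y₀ y₁))) ∧
      -- the functor sends a morphism to the morphism that it induces on the quotients
      (∀ (E E' : TwoCrossed.SimpAlg.{u, v} k) (f : E ⟶ E') (n : ℕ) (x : TwoCrossed.NE E n),
        TwoCrossed.TwoCrsComp.component (F.map f) n (e E n (Submodule.Quotient.mk x)) =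
          e E' n (Submodule.Quotient.mk (TwoCrossed.NEmap f n x))) := by
  -- The terms are the quotient modules by construction, and all operations were defined on
  -- representatives, so every formula is definitional.
  exact ⟨TwoCrossed.twoCrossedFunctor conv, fun E n => LinearEquiv.refl k _,
    fun _ _ _ _ => rfl, fun _ _ _ => rfl, fun _ _ _ _ => rfl, fun _ _ _ => rfl,
    fun _ _ _ => rfl, fun _ _ _ _ _ => rfl⟩
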